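/- Let $\mathbb D=\{z\in\mathbb C:|z|<1\}$ and let $0<\alpha<1$. For a locally univalent analytic function $f$ on $\mathbb D$ put $$S_f=\left(\frac{f''}{f'}\right)'-\frac12\left(\frac{f''}{f'}\right)^2,\qquad \|S_f\|=\sup_{z\in\mathbb D}(1-|z|^2)^2|S_f(z)|\in[0,\infty].$$ An analytic function $f$ on $\mathbb D$ with $f(0)=0$ and $f'(0)=1$ is called strongly convex of order $\alpha$ if $f'(z)\neq0$, $1+zf''(z)/f'(z)\ne 0$ and $$\left|\arg\left(1+\frac{zf''(z)}{f'(z)}\right)\right|<\frac{\pi\alpha}{2}\qquad\text{for all } z\in\mathbb D,$$ where $\arg$ is the principal argument. (i) If $f$ is strongly convex of order $\alpha$, then $\|S_f\|\le 2\alpha$. (ii) The bound is sharp: there is exactly one analytic function $f_\alpha$ on $\mathbb D$ with $f_\alpha(0)=0$, $f_\alpha'(0)=1$, $f_\alpha'\ne0$ on $\mathbb D$ and $$1+\frac{zf_\alpha''(z)}{f_\alpha'(z)}=\left(\frac{1+z^2}{1-z^2}\right)^{\alpha}\qquad(z\in\mathbb D),$$ with the principal branch of the power; this $f_\alpha$ is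 strongly convex of order $\alpha$, and it satisfies $S_{f_\alpha}(0)=2\alpha$ and $\|S_{f_\alpha}\|=2\alpha$. -/

import Mathlib

open scoped ENNReal

noncomputable section

/-- The open unit disk of the complex plane. -/
def unitDiskC : Set ℂ := Metric.ball 0 1

/-- Analytic functions on the unit disk with `f 0 = 0` and `f' 0 = 1`. -/
def NormalizedAnalytic (f : ℂ → ℂ) : Prop :=
  DifferentiableOn ℂ f unitDiskC ∧ f 0 = 0 ∧ deriv f 0 = 1

/-- The pre-Schwarzian derivative `f'' / f'`. -/
def preSchwarzian (f : ℂ → ℂ) (z : ℂ) : ℂ := deriv (deriv f) z / deriv f z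

/-- The Schwarzian derivative `(f'' / f')' - (1/2) (f'' / f')²`. -/
def schwarzian (f : ℂ → ℂ) (z : ℂ) : ℂ :=
  deriv (preSchwarzian f) z - (1 / 2) * preSchwarzian f z ^ 2

/-- The hyperbolic sup-norm `sup (1 - |z|²)² |S_f(z)|` over the unit disk, as an element
of `[0, ∞]`, so that no boundedness is presupposed. -/
def schwarzianNorm (f : ℂ → ℂ) : ℝ≥0∞ :=
  ⨆ z ∈ unitDiskC, ENNReal.ofReal ((1 - ‖z‖ ^ 2) ^ 2 * ‖schwarzian f z‖)

/-- Strongly convex functions of order `α`. The conditions `f' ≠ 0` and `1 + z f'' / f' ≠ 0`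
express that the quantity `arg (1 + z f'' / f')` is defined throughout the disk. -/
def StronglyConvexOfOrder (α : ℝ) (f : ℂ → ℂ) : Prop :=
  NormalizedAnalytic f ∧
    ∀ z ∈ unitDiskC, deriv f z ≠ 0 ∧ 1 + z * preSchwarzian f z ≠ 0 ∧
      |(1 + z * preSchwarzian f z).arg| < Real.pi * α / 2

/-- `f` is normalized, locally univalent, and satisfies
`1 + z f'' / f' = ((1 + z²) / (1 - z²)) ^ α` on the unit disk (principal branch of the power). -/
def IsExtremalStronglyConvex (α : ℝ) (f : ℂ → ℂ) : Prop :=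
  NormalizedAnalytic f ∧
    ∀ z ∈ unitDiskC, deriv f z ≠ 0 ∧
      1 + z * preSchwarzian f z = ((1 + z ^ 2) / (1 - z ^ 2)) ^ (α : ℂ)

end

/-! Write `1 + z f''/f' = exp (α ζ)` with `ζ` mapping the disk into the strip `|Im ζ| < π/2` and `ζ
0 = 0`. Then `w = tanh (ζ/2)` is a self-map of the disk fixing the origin, and, with `P = (exp ζ +
1)² / (2 exp ζ)`, one has `P w = sinh ζ` and `z ζ' = P z w'`. Hence `z² S_f = α exp (α ζ) (z ζ' -
sinh (α ζ)/α) = α exp (α ζ) ((sinh ζ - sinh (α ζ)/α) + P (z w' - w))`.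

At `ζ = ξ + iη` put `C = cosh ξ`, `c = cos η`, `E = exp (-α ξ)`, `y = 1 - |z|²`, `D = |sinh ζ - sinh
(α ζ)/α|`. Then `|P| = C + c` and `|w|² = (C - c)/(C + c)`. Schwarz–Pick for `w z / z` gives `|z w'
- w| (1 - |z|²) ≤ |z|² - |w|²`, so `‖S_f‖ ≤ 2α` reduces to the real inequality `quadratic_bound`:
`y² D + y (2c - y (C + c)) ≤ 2 (1 - y) E` for `0 < y ≤ 2c/(C + c)`, the range of `y` being `|w| ≤
|z|`.

What remains is to bound `D`. For `|η| ≤ 1` it is at most the value that makes the quadratic in `y`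
a perfect square; for `|η| ≥ 1` it is at most the value that gives equality at the endpoint `y =
2c/(C + c)`.

For sharpness, `f''/f'` of the extremal function is `2α z + ⋯`, so its Schwarzian at the origin is
`2α`. The function arises by integrating twice, which also yields uniqueness. -/

/-! ### Elementary hyperbolic inequalities. -/

theorem sinh_mul_le_mul_sinh {k x : ℝ} (hk₀ : 0 ≤ k) (hk₁ : k ≤ 1) (hx : 0 ≤ x) :
    Real.sinh (k * x) ≤ k * Real.sinh x := by
  have hmono : MonotoneOn (fun t : ℝ => k * Real.sinh t - Real.sinh (k * t)) (Set.Ici 0) := by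
    apply monotoneOn_of_hasDerivWithinAt_nonneg (convex_Ici 0) (f' := fun t =>
      k * Real.cosh t - Real.cosh (k * t) * (k * 1)) (by fun_prop)
    · intro t _
      exact (((Real.hasDerivAt_sinh t).const_mul k).sub
        (((hasDerivAt_id t).const_mul k).sinh)).hasDerivWithinAt
    · intro t ht
      rw [interior_Ici] at ht
      have ht : 0 < t := ht
      have : Real.cosh (k * t) ≤ Real.cosh t := by
        rw [Real.cosh_le_cosh, abs_of_nonneg (by positivity), abs_of_pos ht]
        nlinarith
      nlinarith
  have := hmono (Set.mem_Ici.2 le_rfl) (Set.mem_Ici.2 hx) hx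
  simp at this
  exact this

theorem sinh_le_mul_cosh {x : ℝ} (hx : 0 ≤ x) : Real.sinh x ≤ x * Real.cosh x := by
  have hmono : MonotoneOn (fun t : ℝ => t * Real.cosh t - Real.sinh t) (Set.Ici 0) := by
    apply monotoneOn_of_hasDerivWithinAt_nonneg (convex_Ici 0) (f' := fun t =>
      (1 * Real.cosh t + t * Real.sinh t) - Real.cosh t) (by fun_prop)
    · intro t _
      exact (((hasDerivAt_id t).mul (Real.hasDerivAt_cosh t)).sub
        (Real.hasDerivAt_sinh t)).hasDerivWithinAt
    · intro t ht
      rw [interior_Ici] at ht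
      have ht : 0 < t := ht
      have := Real.sinh_pos_iff.2 ht
      nlinarith [mul_pos ht this]
  have := hmono (Set.mem_Ici.2 le_rfl) (Set.mem_Ici.2 hx) hx
  simp at this
  exact this

/-- Since `cosh ξ - sinh ξ = exp (-ξ)`, the claim is that `exp (-t) - cosh (α t) + sinh (α t)/α`,
which vanishes at `0`, is nonnegative. Its derivative is at least `(1 - α) sinh (α t)`, because `exp
(-t) ≤ exp (-α t)`. -/
theorem sinh_sub_le_cosh_sub {α ξ : ℝ} (hα₀ : 0 < α) (hα₁ : α < 1) (hξ : 0 ≤ ξ) :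
    Real.sinh ξ - Real.sinh (α * ξ) / α ≤ Real.cosh ξ - Real.cosh (α * ξ) := by
  have hmono : MonotoneOn (fun t : ℝ => Real.exp (-t) - Real.cosh (α * t) +
      Real.sinh (α * t) / α) (Set.Ici 0) := by
    apply monotoneOn_of_hasDerivWithinAt_nonneg (convex_Ici 0) (f' := fun t =>
      Real.exp (-t) * (-1) - Real.sinh (α * t) * (α * 1) + Real.cosh (α * t) * (α * 1) / α)
      (by fun_prop)
    · intro t _
      exact ((((hasDerivAt_id t).neg.exp).sub (((hasDerivAt_id t).const_mul α).cosh)).add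
        ((((hasDerivAt_id t).const_mul α).sinh).div_const α)).hasDerivWithinAt
    · intro t ht
      rw [interior_Ici] at ht
      have ht : 0 < t := ht
      have h1 : Real.exp (-t) ≤ Real.exp (-(α * t)) := by
        apply Real.exp_le_exp.2; nlinarith
      have h2 := Real.cosh_sub_sinh (α * t)
      have h3 : 0 < Real.sinh (α * t) := Real.sinh_pos_iff.2 (by positivity)
      have h4 : Real.cosh (α * t) * (α * 1) / α = Real.cosh (α * t) := by field_simp
      rw [h4]
      nlinarith
  have := hmono (Set.mem_Ici.2 le_rfl) (Set.mem_Ici.2 hξ) hξ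
  simp at this
  have h2 := Real.cosh_sub_sinh ξ
  linarith

/-- The difference of the two cosines factors as `2 sinh ((1+α)ξ/2) sinh ((1-α)ξ/2)`. The second
factor is bounded below by its argument, the first by `sinh (k x) ≤ k sinh x` with `k = 2α/(1+α)`.
-/
theorem mul_sinh_le_cosh_sub {α ξ : ℝ} (hα₀ : 0 < α) (hα₁ : α < 1) (hξ : 0 ≤ ξ) :
    (1 - α) * (1 + α) / 2 * ξ * (Real.sinh (α * ξ) / α) ≤ Real.cosh ξ - Real.cosh (α * ξ) := by
  have hM : Real.cosh ξ - Real.cosh (α * ξ) =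
      2 * Real.sinh ((1 + α) * ξ / 2) * Real.sinh ((1 - α) * ξ / 2) := by
    have h1 := Real.cosh_add ((1 + α) * ξ / 2) ((1 - α) * ξ / 2)
    have h2 := Real.cosh_sub ((1 + α) * ξ / 2) ((1 - α) * ξ / 2)
    rw [show (1 + α) * ξ / 2 + (1 - α) * ξ / 2 = ξ by ring] at h1
    rw [show (1 + α) * ξ / 2 - (1 - α) * ξ / 2 = α * ξ by ring] at h2
    linarith
  have h1 : (1 - α) * ξ / 2 ≤ Real.sinh ((1 - α) * ξ / 2) :=
    Real.self_le_sinh_iff.2 (by have : 0 < 1 - α := by linarith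
                                positivity)
  have h2 : (1 + α) / 2 * (Real.sinh (α * ξ) / α) ≤ Real.sinh ((1 + α) * ξ / 2) := by
    have := sinh_mul_le_mul_sinh (k := 2 * α / (1 + α)) (x := (1 + α) * ξ / 2) (by positivity)
      (by rw [div_le_one (by positivity)]; linarith) (by positivity)
    rw [show 2 * α / (1 + α) * ((1 + α) * ξ / 2) = α * ξ by field_simp] at this
    calc (1 + α) / 2 * (Real.sinh (α * ξ) / α)
        ≤ (1 + α) / 2 * (2 * α / (1 + α) * Real.sinh ((1 + α) * ξ / 2) / α) := by gcongr
      _ = _ := by field_simp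
  have h3 : 0 ≤ Real.sinh (α * ξ) / α := by
    have := Real.sinh_nonneg_iff.2 (show 0 ≤ α * ξ by positivity)
    positivity
  have h4 : 0 ≤ (1 - α) * ξ / 2 := by
    have : 0 < 1 - α := by linarith
    positivity
  have := mul_le_mul h2 h1 h4 (le_trans (by positivity) h2)
  rw [hM]
  nlinarith

/-- Convexity gives `exp (α ξ) ≤ α exp ξ + (1 - α)`; then `exp ξ ≤ 2 cosh ξ` and `1 ≤ cosh ξ`. -/
theorem exp_mul_le_cosh {α : ℝ} (hα₀ : 0 < α) (hα₁ : α < 1) (ξ : ℝ) :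
    Real.exp (α * ξ) ≤ (1 + α) * Real.cosh ξ := by
  have h := convexOn_exp.2 (Set.mem_univ ξ) (Set.mem_univ 0) hα₀.le (sub_nonneg.2 hα₁.le) (by ring)
  simp at h
  have h1 := Real.one_le_cosh ξ
  have h2 : Real.exp ξ ≤ 2 * Real.cosh ξ := by
    rw [Real.cosh_eq]; linarith [Real.exp_pos (-ξ)]
  nlinarith

/-! ### Upper bounds for `|sinh ζ - sinh (α ζ)/α|` in the strip. -/

/-- Expansion of `|sinh ζ - sinh (α ζ) / α|²` at `ζ = ξ + i η`. -/
theorem normSq_sinh_sub_eq (α ξ η : ℝ) (hα : α ≠ 0) :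
    (Real.sinh ξ * Real.cos η - Real.sinh (α * ξ) / α * Real.cos (α * η)) ^ 2 +
      (Real.cosh ξ * Real.sin η - Real.cosh (α * ξ) * (Real.sin (α * η) / α)) ^ 2 =
    (Real.sinh ξ - Real.sinh (α * ξ) / α) ^ 2 + (Real.sin (α * η) / α - Real.sin η) ^ 2 +
      Real.sinh (α * ξ) / α * Real.sinh ξ * (2 * (1 - Real.cos ((1 - α) * η))) -
      Real.sin (α * η) / α * Real.sin η * (2 * (Real.cosh ((1 - α) * ξ) - 1)) := by
  rw [show (1 - α) * η = η - α * η by ring, show (1 - α) * ξ = ξ - α * ξ by ring,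
    Real.cos_sub, Real.cosh_sub]
  have h1 := Real.cosh_sq ξ
  have h2 := Real.cosh_sq (α * ξ)
  have h3 := Real.sin_sq_add_cos_sq η
  have h4 := Real.sin_sq_add_cos_sq (α * η)
  obtain ⟨A, hA⟩ : ∃ A, A = Real.sinh (α * ξ) / α := ⟨_, rfl⟩
  obtain ⟨m, hm⟩ : ∃ m, m = Real.sin (α * η) / α := ⟨_, rfl⟩
  have hA' : Real.sinh (α * ξ) = α * A := by rw [hA]; field_simp
  have hm' : Real.sin (α * η) = α * m := by rw [hm]; field_simp
  rw [← hA, ← hm]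
  rw [hA'] at h2 ⊢
  rw [hm'] at h4 ⊢
  linear_combination (Real.sin η) ^ 2 * h1 + m ^ 2 * h2 + (Real.sinh ξ) ^ 2 * h3 + A ^ 2 * h4

/-- The surplus of `(cosh ξ - cosh (α ξ))²` over the value of the expansion at `η = 0`. The same
term `2 (cosh ((1-α)ξ) - 1)` occurs here and in the expansion, so it cancels in the estimates below.
-/
theorem cosh_sub_sq_sub_sinh_sub_sq (α ξ : ℝ) (hα : α ≠ 0) :
    (Real.cosh ξ - Real.cosh (α * ξ)) ^ 2 - (Real.sinh ξ - Real.sinh (α * ξ) / α) ^ 2 =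
    (1 - α) * (Real.sinh (α * ξ) / α) *
      (2 * Real.sinh ξ - (1 + α) * (Real.sinh (α * ξ) / α)) -
      2 * (Real.cosh ((1 - α) * ξ) - 1) := by
  rw [show (1 - α) * ξ = ξ - α * ξ by ring, Real.cosh_sub]
  have h1 := Real.cosh_sq ξ
  have h2 := Real.cosh_sq (α * ξ)
  obtain ⟨A, hA⟩ : ∃ A, A = Real.sinh (α * ξ) / α := ⟨_, rfl⟩
  have hA' : Real.sinh (α * ξ) = α * A := by rw [hA]; field_simp
  rw [← hA]
  rw [hA'] at h2 ⊢
  linear_combination h1 + h2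

theorem two_mul_one_sub_cos_le (t : ℝ) : 2 * (1 - Real.cos t) ≤ t ^ 2 := by
  linarith [Real.one_sub_sq_div_two_le_cos (x := t)]

theorem sin_le_sin_mul_div {α η : ℝ} (hα₀ : 0 < α) (hα₁ : α < 1) (hη₀ : 0 ≤ η)
    (hη₁ : η ≤ Real.pi / 2) : Real.sin η ≤ Real.sin (α * η) / α := by
  have h := strictConcaveOn_sin_Icc.concaveOn.2 (x := η) (y := 0)
    ⟨hη₀, by linarith [Real.pi_pos]⟩ ⟨le_rfl, Real.pi_pos.le⟩ hα₀.le (sub_nonneg.2 hα₁.le) (by ring)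
  simp at h
  rw [le_div_iff₀ hα₀]; linarith

theorem sin_mul_div_le {α η : ℝ} (hα₀ : 0 < α) (hη₀ : 0 ≤ η) : Real.sin (α * η) / α ≤ η := by
  rw [div_le_iff₀ hα₀]
  linarith [Real.sin_le (show 0 ≤ α * η by positivity)]

/-- Here `A = sinh (α ξ)/α`, `S = sinh ξ`, `M = cosh ξ - cosh (α ξ)`, `m = sin (α η)/α`, `s = sin
η`, `e = exp (α ξ)`. On the right, `(s² e/2)²` pays for `(m - s)²`. Since `s² ≤ 1`, the surplus `M²
- (S - A)²` is at least `s²` times itself, and its `X` part is cancelled by `m s X ≥ s² X`. The `Y`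
term is also of order `s²`, so after division by `s²` there remains `hkey`. -/
theorem sq_bound_algebra_small {α ξ η A S M X Y m s e : ℝ} (hα₀ : 0 < α) (hα₁ : α < 1)
    (hA₀ : 0 ≤ A) (hAS : A ≤ S) (hAe : A ≤ ξ * e) (hX : 0 ≤ X)
    (hY : Y ≤ ((1 - α) * η) ^ 2) (hηq : η ^ 2 ≤ 3 / 2 * s ^ 2) (hs₀ : 0 ≤ s) (hms : s ≤ m)
    (hmq : m - s ≤ s ^ 2 / 2) (hs₁ : s ≤ 1) (he : 1 ≤ e)
    (hΔ : M ^ 2 - (S - A) ^ 2 = (1 - α) * A * (2 * S - (1 + α) * A) - X)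
    (hGM : S - A ≤ M) (hMA : (1 - α) * (1 + α) / 2 * ξ * A ≤ M) :
    (S - A) ^ 2 + (m - s) ^ 2 + A * S * Y - m * s * X ≤ (M + s ^ 2 * e / 2) ^ 2 := by
  have hβ : 0 < 1 - α := by linarith
  have hM₀ : 0 ≤ M := by linarith
  have hq₁ : s ^ 2 ≤ 1 := pow_le_one₀ hs₀ hs₁
  have hm2 : (m - s) ^ 2 ≤ (s ^ 2 * e / 2) ^ 2 := by
    apply pow_le_pow_left₀ (by linarith)
    have := le_mul_of_one_le_right (sq_nonneg s) he
    linarith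
  have h0 : 0 ≤ A * S := mul_nonneg hA₀ (hA₀.trans hAS)
  have hASY : A * S * Y ≤ s ^ 2 * (3 / 2 * ((1 - α) ^ 2 * (A * S))) := by
    have : Y ≤ (1 - α) ^ 2 * (3 / 2 * s ^ 2) := by
      calc Y ≤ (1 - α) ^ 2 * η ^ 2 := by rw [← mul_pow]; exact hY
        _ ≤ _ := by gcongr
    linarith [mul_le_mul_of_nonneg_left this h0]
  have hmsX : s ^ 2 * X ≤ m * s * X := by
    apply mul_le_mul_of_nonneg_right _ hX
    rw [sq]
    exact mul_le_mul_of_nonneg_right hms hs₀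
  have hΔ₀ : 0 ≤ M ^ 2 - (S - A) ^ 2 :=
    sub_nonneg.2 (pow_le_pow_left₀ (sub_nonneg.2 hAS) hGM 2)
  have hΔq : s ^ 2 * (M ^ 2 - (S - A) ^ 2) ≤ M ^ 2 - (S - A) ^ 2 :=
    mul_le_of_le_one_left hΔ₀ hq₁
  have heM : (1 - α) * (1 + α) / 2 * A ^ 2 ≤ e * M := by
    calc (1 - α) * (1 + α) / 2 * A ^ 2 = (1 - α) * (1 + α) / 2 * A * A := by ring
      _ ≤ (1 - α) * (1 + α) / 2 * A * (ξ * e) := by gcongr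
      _ = e * ((1 - α) * (1 + α) / 2 * ξ * A) := by ring
      _ ≤ e * M := by gcongr
  have hkey : 3 / 2 * ((1 - α) ^ 2 * (A * S)) ≤
      (1 - α) * A * (2 * S - (1 + α) * A) + e * M := by
    have h1 : 0 ≤ (1 - α) * A := by positivity
    have h2 : 3 / 2 * (1 - α) * S ≤ 2 * S - (1 + α) * A / 2 := by
      nlinarith only [hAS, hα₀, hA₀]
    linarith [mul_le_mul_of_nonneg_left h2 h1]
  have hkey' := mul_le_mul_of_nonneg_left hkey (sq_nonneg s)
  rw [hΔ] at hΔq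
  linarith

/-- The bound for `|sinh ζ - sinh (α ζ) / α|` when `|Im ζ| ≤ 1`. -/
theorem normSq_sinh_sub_le_of_le_one {α ξ η : ℝ} (hα₀ : 0 < α) (hα₁ : α < 1) (hξ : 0 ≤ ξ)
    (hη₀ : 0 ≤ η) (hη₁ : η ≤ 1) :
    (Real.sinh ξ * Real.cos η - Real.sinh (α * ξ) / α * Real.cos (α * η)) ^ 2 +
      (Real.cosh ξ * Real.sin η - Real.cosh (α * ξ) * (Real.sin (α * η) / α)) ^ 2 ≤
    (Real.cosh ξ - Real.cosh (α * ξ) + Real.sin η ^ 2 * Real.exp (α * ξ) / 2) ^ 2 := by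
  rw [normSq_sinh_sub_eq α ξ η hα₀.ne']
  have hΔ := cosh_sub_sq_sub_sinh_sub_sq α ξ hα₀.ne'
  have hY := two_mul_one_sub_cos_le ((1 - α) * η)
  have hX : 0 ≤ 2 * (Real.cosh ((1 - α) * ξ) - 1) := by
    linarith [Real.one_le_cosh ((1 - α) * ξ)]
  have hGM := sinh_sub_le_cosh_sub hα₀ hα₁ hξ
  have hMA := mul_sinh_le_cosh_sub hα₀ hα₁ hξ
  have hms := sin_le_sin_mul_div hα₀ hα₁ hη₀ (by linarith [Real.pi_gt_three])
  have hmη := sin_mul_div_le hα₀ hη₀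
  have hA₀ : 0 ≤ Real.sinh (α * ξ) / α :=
    div_nonneg (Real.sinh_nonneg_iff.2 (by positivity)) hα₀.le
  have hAS : Real.sinh (α * ξ) / α ≤ Real.sinh ξ := by
    rw [div_le_iff₀ hα₀]; linarith [sinh_mul_le_mul_sinh hα₀.le hα₁.le hξ]
  have hAe : Real.sinh (α * ξ) / α ≤ ξ * Real.exp (α * ξ) := by
    rw [div_le_iff₀ hα₀]
    have h1 := sinh_le_mul_cosh (show 0 ≤ α * ξ by positivity)
    have h2 : Real.cosh (α * ξ) ≤ Real.exp (α * ξ) := by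
      have := Real.cosh_add_sinh (α * ξ)
      have := Real.sinh_nonneg_iff.2 (show 0 ≤ α * ξ by positivity)
      linarith
    nlinarith [mul_le_mul_of_nonneg_left h2 (show 0 ≤ α * ξ by positivity)]
  have he : 1 ≤ Real.exp (α * ξ) := Real.one_le_exp (by positivity)
  have hs₀ : 0 ≤ Real.sin η := Real.sin_nonneg_of_nonneg_of_le_pi hη₀ (by linarith [Real.pi_gt_three])
  have hs₁ : Real.sin η ≤ 1 := Real.sin_le_one η
  have hsη : η - η ^ 3 / 6 ≤ Real.sin η := Real.sin_ge_sub_cube hη₀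
  -- From `η³ ≤ η` on `[0, 1]`. The squared ratio `36/25` is below the `3/2` needed next.
  have h56 : 5 / 6 * η ≤ Real.sin η := by
    have : η ^ 3 ≤ η := by
      calc η ^ 3 ≤ η ^ 1 := pow_le_pow_of_le_one hη₀ hη₁ (by norm_num)
        _ = η := pow_one η
    linarith
  have hηq : η ^ 2 ≤ 3 / 2 * Real.sin η ^ 2 := by
    have := pow_le_pow_left₀ (by positivity) h56 2
    nlinarith only [this, sq_nonneg η]
  have hηs : η - Real.sin η ≤ Real.sin η ^ 2 / 2 := by
    have h1 := pow_le_pow_left₀ (by positivity) h56 2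
    have h2 : η ^ 3 ≤ η ^ 2 := pow_le_pow_of_le_one hη₀ hη₁ (by norm_num)
    nlinarith only [h1, h2, hsη, sq_nonneg η]
  exact sq_bound_algebra_small hα₀ hα₁ hA₀ hAS hAe hX hY hηq hs₀ hms (by linarith)
    hs₁ he hΔ hGM hMA

/-- The same scheme, with `C = cosh ξ`, `E = exp (-α ξ)`, `t = tan² η` and `N` the excess of the
bound over `M`. Numerically, `cos 1 ≤ 5/9` gives `s² ≥ 56/81` and `t ≥ (81/25) s²`, and Jordan's
inequality gives `η ≤ (π/2) s`, with `1.5708² < 2.4675`. One unit of the coefficient `2.4675` is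
paid by the surplus (`hkey₂`), the other `1.4675` by the cross term `2 M N` (`hkey`). -/
theorem sq_bound_algebra_large {α ξ η A S M X Y m s C E t N : ℝ} (hα₀ : 0 < α) (hα₁ : α < 1)
    (hξ : 0 ≤ ξ) (hA₀ : 0 ≤ A) (hAS : A ≤ S) (hX : 0 ≤ X)
    (hY : Y ≤ ((1 - α) * η) ^ 2) (hη : 0 ≤ η) (hηs : η ≤ 1.5708 * s) (hs₀ : 0 ≤ s) (hms : s ≤ m)
    (hmη : m ≤ η) (hs₁ : s ≤ 1) (hs2 : 56 / 81 ≤ s ^ 2) (hSC : S ≤ ξ * C) (hC : 1 ≤ C) (hE : 0 < E)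
    (hEC : 1 ≤ (1 + α) * (E * C)) (hst : 81 / 25 * s ^ 2 ≤ t) (hNt : E * C ^ 2 * t ≤ 2 * N)
    (hΔ : M ^ 2 - (S - A) ^ 2 = (1 - α) * A * (2 * S - (1 + α) * A) - X)
    (hGM : S - A ≤ M) (hMA : (1 - α) * (1 + α) / 2 * ξ * A ≤ M) :
    (S - A) ^ 2 + (m - s) ^ 2 + A * S * Y - m * s * X ≤ (M + N) ^ 2 := by
  have hβ : 0 < 1 - α := by linarith
  have hM₀ : 0 ≤ M := by linarith
  have hq₁ : s ^ 2 ≤ 1 := pow_le_one₀ hs₀ hs₁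
  have hs83 : 0.83 ≤ s := by nlinarith only [hs2, hs₀]
  have hEC2 : 1 / 2 ≤ E * C ^ 2 := by
    have h0 : 0 < E * C := by positivity
    have h1 : 1 / 2 ≤ E * C := by nlinarith only [hEC, h0, hα₁]
    nlinarith only [h1, hC]
  have hNq : 81 / 50 * s ^ 2 * (E * C ^ 2) ≤ N := by
    linarith [mul_le_mul_of_nonneg_left hst (show 0 ≤ E * C ^ 2 by positivity)]
  have hN₁ : 0.81 * s ^ 2 ≤ N := by
    linarith [mul_le_mul_of_nonneg_left hEC2 (show 0 ≤ 81 / 50 * s ^ 2 by positivity)]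
  have hm2 : (m - s) ^ 2 ≤ N ^ 2 := by
    apply pow_le_pow_left₀ (by linarith)
    nlinarith only [hN₁, hs83, hmη, hηs]
  have h0 : 0 ≤ A * S := mul_nonneg hA₀ (hA₀.trans hAS)
  have hASY : A * S * Y ≤ s ^ 2 * (2.4675 * ((1 - α) ^ 2 * (A * S))) := by
    have hη2 : η ^ 2 ≤ 2.4675 * s ^ 2 := by
      have := pow_le_pow_left₀ hη hηs 2
      nlinarith only [this, sq_nonneg s]
    have : Y ≤ (1 - α) ^ 2 * (2.4675 * s ^ 2) := by
      calc Y ≤ (1 - α) ^ 2 * η ^ 2 := by rw [← mul_pow]; exact hY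
        _ ≤ _ := by gcongr
    linarith [mul_le_mul_of_nonneg_left this h0]
  have hmsX : s ^ 2 * X ≤ m * s * X := by
    apply mul_le_mul_of_nonneg_right _ hX
    rw [sq]
    exact mul_le_mul_of_nonneg_right hms hs₀
  have hΔ₀ : 0 ≤ M ^ 2 - (S - A) ^ 2 :=
    sub_nonneg.2 (pow_le_pow_left₀ (sub_nonneg.2 hAS) hGM 2)
  have hΔq : s ^ 2 * (M ^ 2 - (S - A) ^ 2) ≤ M ^ 2 - (S - A) ^ 2 :=
    mul_le_of_le_one_left hΔ₀ hq₁
  have hkey : 1.4675 * ((1 - α) ^ 2 * (A * S)) ≤ 81 / 25 * (E * C ^ 2) * M := by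
    have h2 : 1.4675 * (1 - α) * S ≤ 81 / 50 * (ξ * C) * ((1 + α) * (E * C)) := by
      have h3 : 0 ≤ ξ * C := by positivity
      calc 1.4675 * (1 - α) * S ≤ 1.4675 * S := by nlinarith only [hα₀, hA₀, hAS]
        _ ≤ 81 / 50 * (ξ * C) := by linarith
        _ ≤ _ := le_mul_of_one_le_right (by positivity) hEC
    have h1 : 0 ≤ (1 - α) * A := by positivity
    calc 1.4675 * ((1 - α) ^ 2 * (A * S)) = (1 - α) * A * (1.4675 * (1 - α) * S) := by ring
      _ ≤ (1 - α) * A * (81 / 50 * (ξ * C) * ((1 + α) * (E * C))) := by gcongr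
      _ = 81 / 25 * (E * C ^ 2) * ((1 - α) * (1 + α) / 2 * ξ * A) := by ring
      _ ≤ _ := by gcongr
  have hkey₂ : (1 - α) ^ 2 * (A * S) ≤ (1 - α) * A * (2 * S - (1 + α) * A) := by
    have h1 : 0 ≤ (1 - α) * A := by positivity
    have h2 : (1 - α) * S ≤ 2 * S - (1 + α) * A := by
      nlinarith only [hAS, hα₀]
    linarith [mul_le_mul_of_nonneg_left h2 h1]
  have hkey' := mul_le_mul_of_nonneg_left (add_le_add hkey hkey₂) (sq_nonneg s)
  have hMN := mul_le_mul_of_nonneg_right hNq hM₀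
  rw [hΔ] at hΔq
  linarith

/-- The bound for `|sinh ζ - sinh (α ζ) / α|` when `1 ≤ |Im ζ| < π / 2`. -/
theorem normSq_sinh_sub_le_of_one_le {α ξ η : ℝ} (hα₀ : 0 < α) (hα₁ : α < 1) (hξ : 0 ≤ ξ)
    (hη₀ : 1 ≤ η) (hη₁ : η < Real.pi / 2) :
    (Real.sinh ξ * Real.cos η - Real.sinh (α * ξ) / α * Real.cos (α * η)) ^ 2 +
      (Real.cosh ξ * Real.sin η - Real.cosh (α * ξ) * (Real.sin (α * η) / α)) ^ 2 ≤
    (Real.exp (-(α * ξ)) * (Real.cosh ξ ^ 2 - Real.cos η ^ 2) / (2 * Real.cos η ^ 2)) ^ 2 := by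
  have hη : 0 ≤ η := by linarith
  have hc₀ : 0 < Real.cos η := Real.cos_pos_of_mem_Ioo ⟨by linarith [Real.pi_pos], hη₁⟩
  have hc₁ : Real.cos η ≤ 5 / 9 :=
    (Real.cos_le_cos_of_nonneg_of_le_pi zero_le_one (by linarith [Real.pi_pos]) hη₀).trans
      Real.cos_one_le
  obtain ⟨N, hN⟩ : ∃ N, N = Real.exp (-(α * ξ)) / 2 * ((Real.cosh ξ - Real.exp (α * ξ)) ^ 2 +
    Real.cosh ξ ^ 2 * (Real.sin η ^ 2 / Real.cos η ^ 2)) := ⟨_, rfl⟩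
  -- Splitting off `M = cosh ξ - cosh (α ξ)` leaves a remainder that is visibly nonnegative and at
  -- least `E C² tan² η / 2`.
  have hW : Real.exp (-(α * ξ)) * (Real.cosh ξ ^ 2 - Real.cos η ^ 2) / (2 * Real.cos η ^ 2) =
      Real.cosh ξ - Real.cosh (α * ξ) + N := by
    rw [hN, Real.sin_sq, Real.cosh_eq (α * ξ), Real.exp_neg]
    have := Real.exp_pos (α * ξ)
    field_simp
    ring
  rw [hW, normSq_sinh_sub_eq α ξ η hα₀.ne']
  have hΔ := cosh_sub_sq_sub_sinh_sub_sq α ξ hα₀.ne'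
  have hY := two_mul_one_sub_cos_le ((1 - α) * η)
  have hX : 0 ≤ 2 * (Real.cosh ((1 - α) * ξ) - 1) := by
    linarith [Real.one_le_cosh ((1 - α) * ξ)]
  have hGM := sinh_sub_le_cosh_sub hα₀ hα₁ hξ
  have hMA := mul_sinh_le_cosh_sub hα₀ hα₁ hξ
  have hms := sin_le_sin_mul_div hα₀ hα₁ hη hη₁.le
  have hmη := sin_mul_div_le hα₀ hη
  have hA₀ : 0 ≤ Real.sinh (α * ξ) / α :=
    div_nonneg (Real.sinh_nonneg_iff.2 (by positivity)) hα₀.le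
  have hAS : Real.sinh (α * ξ) / α ≤ Real.sinh ξ := by
    rw [div_le_iff₀ hα₀]; linarith [sinh_mul_le_mul_sinh hα₀.le hα₁.le hξ]
  have hSC := sinh_le_mul_cosh hξ
  have hC := Real.one_le_cosh ξ
  have hEC : 1 ≤ (1 + α) * (Real.exp (-(α * ξ)) * Real.cosh ξ) := by
    have h := exp_mul_le_cosh hα₀ hα₁ ξ
    rw [Real.exp_neg]
    have := Real.exp_pos (α * ξ)
    rw [show (1 + α) * ((Real.exp (α * ξ))⁻¹ * Real.cosh ξ) =
      ((1 + α) * Real.cosh ξ) / Real.exp (α * ξ) by field_simp, le_div_iff₀ this]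
    linarith
  have hE := Real.exp_pos (-(α * ξ))
  have hNt : Real.exp (-(α * ξ)) * Real.cosh ξ ^ 2 * (Real.sin η ^ 2 / Real.cos η ^ 2) ≤ 2 * N := by
    rw [hN]; nlinarith [sq_nonneg (Real.cosh ξ - Real.exp (α * ξ))]
  have hsc := Real.sin_sq_add_cos_sq η
  have hc2 : Real.cos η ^ 2 ≤ 25 / 81 := by nlinarith
  have hs₀ : 0 ≤ Real.sin η := Real.sin_nonneg_of_nonneg_of_le_pi hη (by linarith [Real.pi_gt_three])
  have hs₁ : Real.sin η ≤ 1 := Real.sin_le_one η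
  have hst : 81 / 25 * Real.sin η ^ 2 ≤ Real.sin η ^ 2 / Real.cos η ^ 2 := by
    rw [le_div_iff₀ (by positivity)]
    nlinarith [sq_nonneg (Real.sin η)]
  have hηs : η ≤ 1.5708 * Real.sin η := by
    have h := Real.mul_le_sin hη hη₁.le
    have hpi := Real.pi_lt_d4
    have h2 : η ≤ Real.pi / 2 * Real.sin η := by
      calc η = Real.pi / 2 * (2 / Real.pi * η) := by field_simp
        _ ≤ _ := by gcongr
    linarith [mul_le_mul_of_nonneg_right (show Real.pi / 2 ≤ 1.5708 by linarith) hs₀]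
  exact sq_bound_algebra_large hα₀ hα₁ hξ hA₀ hAS hX hY hη hηs hs₀ hms hmη hs₁ (by linarith)
    hSC hC hE hEC hst hNt hΔ hGM hMA

/-! ### The quadratic inequality in `y = 1 - |z|²`. -/

theorem quadratic_bound_of_nonneg {α ξ η y D : ℝ} (hα₀ : 0 < α) (hα₁ : α < 1) (hξ : 0 ≤ ξ)
    (hη₀ : 0 ≤ η) (hη₁ : η < Real.pi / 2)
    (hD : D ^ 2 =
      (Real.sinh ξ * Real.cos η - Real.sinh (α * ξ) / α * Real.cos (α * η)) ^ 2 +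
      (Real.cosh ξ * Real.sin η - Real.cosh (α * ξ) * (Real.sin (α * η) / α)) ^ 2)
    (hy₀ : 0 < y) (hy₁ : y * (Real.cosh ξ + Real.cos η) ≤ 2 * Real.cos η) :
    y ^ 2 * D + 2 * Real.cos η * y - y ^ 2 * (Real.cosh ξ + Real.cos η) ≤
      2 * (1 - y) * Real.exp (-(α * ξ)) := by
  have hc₀ : 0 < Real.cos η := Real.cos_pos_of_mem_Ioo ⟨by linarith [Real.pi_pos], hη₁⟩
  have hC := Real.one_le_cosh ξ
  have hE := Real.exp_pos (-(α * ξ))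
  rcases le_total η 1 with h | h
  · have hb := normSq_sinh_sub_le_of_le_one hα₀ hα₁ hξ hη₀ h
    rw [← hD] at hb
    have hM : 0 ≤ Real.cosh ξ - Real.cosh (α * ξ) := by
      rw [sub_nonneg, Real.cosh_le_cosh, abs_of_nonneg (by positivity), abs_of_nonneg hξ]
      nlinarith
    have hDU := le_of_sq_le_sq hb (by positivity)
    have hch : Real.cosh (α * ξ) = ((Real.exp (-(α * ξ)))⁻¹ + Real.exp (-(α * ξ))) / 2 := by
      rw [Real.cosh_eq, Real.exp_neg, inv_inv]
    have hee : Real.exp (α * ξ) = (Real.exp (-(α * ξ)))⁻¹ := by rw [Real.exp_neg, inv_inv]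
    rw [hch, hee, Real.sin_sq] at hDU
    generalize Real.exp (-(α * ξ)) = E at *
    generalize Real.cos η = c at *
    generalize Real.cosh ξ = C at *
    -- The bound on `D` for `η ≤ 1` is the value at which the discriminant in `y` vanishes.
    have hsq : 2 * (1 - y) * E - (y ^ 2 * (C - (E⁻¹ + E) / 2 + (1 - c ^ 2) * E⁻¹ / 2) +
        2 * c * y - y ^ 2 * (C + c)) = (y * (c + E) - 2 * E) ^ 2 / (2 * E) := by
      field_simp
      ring
    have h0 : 0 ≤ (y * (c + E) - 2 * E) ^ 2 / (2 * E) := by positivity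
    nlinarith [mul_le_mul_of_nonneg_left hDU (sq_nonneg y)]
  · have hb := normSq_sinh_sub_le_of_one_le hα₀ hα₁ hξ h hη₁
    rw [← hD] at hb
    have hc1 : Real.cos η ^ 2 ≤ 1 := Real.cos_sq_le_one η
    have hW₀ : 0 ≤ Real.cosh ξ ^ 2 - Real.cos η ^ 2 := by nlinarith
    have hDW := le_of_sq_le_sq hb (by positivity)
    have hc₁ : Real.cos η ≤ 5 / 9 :=
      (Real.cos_le_cos_of_nonneg_of_le_pi zero_le_one (by linarith [Real.pi_pos]) h).trans
        Real.cos_one_le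
    have hEC : Real.cos η ^ 2 ≤ Real.exp (-(α * ξ)) * Real.cosh ξ := by
      have h1 := exp_mul_le_cosh hα₀ hα₁ ξ
      have h2 : Real.exp (-(α * ξ)) * Real.exp (α * ξ) = 1 := by rw [← Real.exp_add]; simp
      nlinarith [mul_le_mul_of_nonneg_left h1 hE.le, mul_pos hE (Real.cosh_pos ξ)]
    generalize Real.exp (-(α * ξ)) = E at *
    generalize Real.cos η = c at *
    generalize Real.cosh ξ = C at *
    -- The bound on `D` for `η ≥ 1` gives equality at `y = 2c/(C + c)`, whence the linear factor. By
    -- `y (C + c) ≤ 2c`, the other factor is at least `2y (E C - c²)`.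
    have hid : 2 * (1 - y) * E - (y ^ 2 * (E * (C ^ 2 - c ^ 2) / (2 * c ^ 2)) +
        2 * c * y - y ^ 2 * (C + c)) =
        (2 * c - y * (C + c)) * (2 * c * E + y * (E * C - E * c - 2 * c ^ 2)) / (2 * c ^ 2) := by
      field_simp
      ring
    have hu : 0 ≤ 2 * c - y * (C + c) := by linarith
    have hv : 0 ≤ 2 * c * E + y * (E * C - E * c - 2 * c ^ 2) := by
      have h1 := mul_le_mul_of_nonneg_left hEC hy₀.le
      have h2 := mul_le_mul_of_nonneg_right hy₁ hE.le
      linarith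
    have h0 : 0 ≤ (2 * c - y * (C + c)) * (2 * c * E + y * (E * C - E * c - 2 * c ^ 2)) /
        (2 * c ^ 2) := by positivity
    linarith [mul_le_mul_of_nonneg_left hDW (sq_nonneg y)]

/-- The real inequality behind the estimate of the Schwarzian; here
`D = |sinh ζ - sinh (α ζ) / α|` with `ζ = ξ + i η`. -/
theorem quadratic_bound {α ξ η y D : ℝ} (hα₀ : 0 < α) (hα₁ : α < 1) (hη : |η| < Real.pi / 2)
    (hD : D ^ 2 =
      (Real.sinh ξ * Real.cos η - Real.sinh (α * ξ) / α * Real.cos (α * η)) ^ 2 +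
      (Real.cosh ξ * Real.sin η - Real.cosh (α * ξ) * (Real.sin (α * η) / α)) ^ 2)
    (hy₀ : 0 < y) (hy₁ : y * (Real.cosh ξ + Real.cos η) ≤ 2 * Real.cos η) :
    y ^ 2 * D + 2 * Real.cos η * y - y ^ 2 * (Real.cosh ξ + Real.cos η) ≤
      2 * (1 - y) * Real.exp (-(α * ξ)) := by
  have hD' : D ^ 2 =
      (Real.sinh |ξ| * Real.cos |η| - Real.sinh (α * |ξ|) / α * Real.cos (α * |η|)) ^ 2 +
      (Real.cosh |ξ| * Real.sin |η| - Real.cosh (α * |ξ|) * (Real.sin (α * |η|) / α)) ^ 2 := by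
    rw [hD]
    rcases abs_cases ξ with h | h <;> rcases abs_cases η with h' | h' <;>
      simp only [h.1, h'.1, mul_neg, Real.sinh_neg, Real.cosh_neg, Real.sin_neg, Real.cos_neg] <;>
      ring
  have hy₂ : y * (Real.cosh |ξ| + Real.cos |η|) ≤ 2 * Real.cos |η| := by
    rwa [Real.cosh_abs, Real.cos_abs]
  have h := quadratic_bound_of_nonneg hα₀ hα₁ (abs_nonneg ξ) (abs_nonneg η) hη hD' hy₀ hy₂
  rw [Real.cosh_abs, Real.cos_abs] at h
  -- Replacing `ξ` by `|ξ|` leaves the left side unchanged and can only decrease `exp (-α ξ)`; `y ≤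
  -- 1` keeps the coefficient nonnegative.
  refine h.trans (mul_le_mul_of_nonneg_left (Real.exp_le_exp.2 ?_) ?_)
  · nlinarith [le_abs_self ξ]
  · have hc : 0 < Real.cos η := Real.cos_pos_of_mem_Ioo (abs_lt.1 hη)
    have := Real.one_le_cosh ξ
    have := Real.cos_le_one η
    have : y ≤ 1 := by
      by_contra hy
      nlinarith
    linarith

/-! ### Schwarz–Pick estimates. -/

open ComplexConjugate in
theorem norm_mobius_lt_one {a t : ℂ} (ha : ‖a‖ < 1) (ht : ‖t‖ < 1) :
    1 + conj a * t ≠ 0 ∧ ‖(t + a) / (1 + conj a * t)‖ < 1 := by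
  have hne : 1 + conj a * t ≠ 0 := by
    intro h
    have h1 : ‖conj a * t‖ = 1 := by
      rw [show conj a * t = -1 by linear_combination h]; simp
    rw [norm_mul, Complex.norm_conj] at h1
    nlinarith [norm_nonneg a, norm_nonneg t]
  refine ⟨hne, ?_⟩
  rw [norm_div, div_lt_one (norm_pos_iff.2 hne)]
  apply lt_of_pow_lt_pow_left₀ 2 (norm_nonneg _)
  have ha2 : ‖a‖ ^ 2 < 1 := pow_lt_one₀ (norm_nonneg _) ha two_ne_zero
  have ht2 : ‖t‖ ^ 2 < 1 := pow_lt_one₀ (norm_nonneg _) ht two_ne_zero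
  rw [Complex.sq_norm, Complex.normSq_apply] at *
  rw [Complex.sq_norm, Complex.normSq_apply] at *
  simp
  nlinarith

open ComplexConjugate in
theorem hasDerivAt_mobius (a : ℂ) {t : ℂ} (ht : 1 + conj a * t ≠ 0) :
    HasDerivAt (fun t : ℂ => (t + a) / (1 + conj a * t))
      ((1 - conj a * a) / (1 + conj a * t) ^ 2) t := by
  refine (((hasDerivAt_id t).add_const a).div
    (((hasDerivAt_id t).const_mul (conj a)).const_add 1) ht).congr_deriv ?_
  simp only [id]
  ring

open ComplexConjugate in
/-- The Schwarz–Pick inequality for the derivative. -/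
theorem norm_deriv_mul_le_one_sub_sq {g : ℂ → ℂ} (hd : DifferentiableOn ℂ g (Metric.ball 0 1))
    (hm : ∀ z ∈ Metric.ball (0 : ℂ) 1, ‖g z‖ < 1) {a : ℂ} (ha : ‖a‖ < 1) :
    ‖deriv g a‖ * (1 - ‖a‖ ^ 2) ≤ 1 - ‖g a‖ ^ 2 := by
  have ha' : a ∈ Metric.ball (0 : ℂ) 1 := by simpa using ha
  have hb : ‖-g a‖ < 1 := by simpa using hm a ha'
  have hψ : ∀ t ∈ Metric.ball (0 : ℂ) 1,
      (t + a) / (1 + conj a * t) ∈ Metric.ball (0 : ℂ) 1 := fun t ht => by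
    simpa using (norm_mobius_lt_one ha (by simpa using ht)).2
  have hgd : ∀ z ∈ Metric.ball (0 : ℂ) 1, HasDerivAt g (deriv g z) z := fun z hz =>
    (hd.differentiableAt (Metric.isOpen_ball.mem_nhds hz)).hasDerivAt
  -- `g` is composed with the disk automorphisms carrying `0` to `a` and `g a` to `0`; the
  -- derivative at `0` of the composite has norm at most `1`.
  have hcomp : ∀ t ∈ Metric.ball (0 : ℂ) 1, HasDerivAt
      ((fun t : ℂ => (t + -g a) / (1 + conj (-g a) * t)) ∘ g ∘
        (fun t : ℂ => (t + a) / (1 + conj a * t)))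
      ((1 - conj (-g a) * (-g a)) / (1 + conj (-g a) * g ((t + a) / (1 + conj a * t))) ^ 2 *
        (deriv g ((t + a) / (1 + conj a * t)) *
          ((1 - conj a * a) / (1 + conj a * t) ^ 2))) t := by
    intro t ht
    refine HasDerivAt.comp t (hasDerivAt_mobius _ (norm_mobius_lt_one hb ?_).1)
      (HasDerivAt.comp t (hgd _ (hψ t ht))
        (hasDerivAt_mobius a (norm_mobius_lt_one ha (by simpa using ht)).1))
    exact hm _ (hψ t ht)
  have h0 : (0 : ℂ) ∈ Metric.ball (0 : ℂ) 1 := by simp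
  have hbound := Complex.norm_deriv_le_one_of_mapsTo_ball (c := 0) (R := 1)
    (fun t ht => (hcomp t ht).differentiableAt.differentiableWithinAt)
    (fun t ht => by
      have := (norm_mobius_lt_one hb (hm _ (hψ t ht))).2.le
      simpa using this) one_pos
  rw [(hcomp 0 h0).deriv] at hbound
  have hb2 : ‖g a‖ ^ 2 < 1 := pow_lt_one₀ (norm_nonneg _) (hm a ha') two_ne_zero
  have ha2 : ‖a‖ ^ 2 < 1 := pow_lt_one₀ (norm_nonneg _) ha two_ne_zero
  have e1 : 1 - conj a * a = ((1 - ‖a‖ ^ 2 : ℝ) : ℂ) := by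
    rw [Complex.conj_mul']; push_cast; ring
  have e2 : 1 - conj (g a) * g a = ((1 - ‖g a‖ ^ 2 : ℝ) : ℂ) := by
    rw [Complex.conj_mul']; push_cast; ring
  have e3 : 1 + -(conj (g a) * g a) = ((1 - ‖g a‖ ^ 2 : ℝ) : ℂ) := by
    rw [Complex.conj_mul']; push_cast; ring
  simp only [zero_add, mul_zero, add_zero, div_one, one_pow, map_neg, neg_mul, mul_neg, neg_neg]
    at hbound
  rw [e1, e2, e3, norm_mul, norm_mul, norm_div, norm_pow, Complex.norm_real, Complex.norm_real,
    Real.norm_of_nonneg (by linarith), Real.norm_of_nonneg (by linarith)] at hbound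
  have hpos : 0 < 1 - ‖g a‖ ^ 2 := by linarith
  rwa [show (1 - ‖g a‖ ^ 2) / (1 - ‖g a‖ ^ 2) ^ 2 * (‖deriv g a‖ * (1 - ‖a‖ ^ 2)) =
    ‖deriv g a‖ * (1 - ‖a‖ ^ 2) / (1 - ‖g a‖ ^ 2) by field_simp, div_le_one hpos] at hbound

/-- The strict version applies to `ρ g` with `ρ < 1`; then `ρ → 1`. The weak hypothesis is needed
for the quotient `w z / z`, which is a unimodular constant when `w` is a rotation. -/
theorem norm_deriv_mul_le_one_sub_sq_of_norm_le_one {g : ℂ → ℂ}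
    (hd : DifferentiableOn ℂ g (Metric.ball 0 1))
    (hm : ∀ z ∈ Metric.ball (0 : ℂ) 1, ‖g z‖ ≤ 1) {a : ℂ} (ha : ‖a‖ < 1) :
    ‖deriv g a‖ * (1 - ‖a‖ ^ 2) ≤ 1 - ‖g a‖ ^ 2 := by
  have key : ∀ ρ ∈ Set.Ioo (0 : ℝ) 1,
      ρ * ‖deriv g a‖ * (1 - ‖a‖ ^ 2) ≤ 1 - ρ ^ 2 * ‖g a‖ ^ 2 := by
    intro ρ hρ
    have h := norm_deriv_mul_le_one_sub_sq (g := fun z => (ρ : ℂ) * g z) (hd.const_mul _)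
      (fun z hz => by
        rw [norm_mul, Complex.norm_real, Real.norm_of_nonneg hρ.1.le]
        nlinarith [hm z hz, hρ.1, hρ.2, norm_nonneg (g z)]) ha
    have hda : DifferentiableAt ℂ g a :=
      hd.differentiableAt (Metric.isOpen_ball.mem_nhds (by simpa using ha))
    rw [deriv_const_mul _ hda, norm_mul, norm_mul, Complex.norm_real,
      Real.norm_of_nonneg hρ.1.le, mul_pow] at h
    exact h
  have hlim : Filter.Tendsto (fun ρ : ℝ => 1 - ρ ^ 2 * ‖g a‖ ^ 2 - ρ * ‖deriv g a‖ * (1 - ‖a‖ ^ 2))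
      (nhdsWithin 1 (Set.Iio 1))
      (nhds (1 - 1 ^ 2 * ‖g a‖ ^ 2 - 1 * ‖deriv g a‖ * (1 - ‖a‖ ^ 2))) :=
    (Continuous.tendsto (by fun_prop) 1).mono_left nhdsWithin_le_nhds
  have := ge_of_tendsto hlim (b := 0) (by
    filter_upwards [Ioo_mem_nhdsLT (zero_lt_one' ℝ)] with ρ hρ
    linarith [key ρ hρ])
  linarith

/-- A Schwarz–Pick estimate for a self-map of the disk which fixes the origin. -/
theorem norm_mul_deriv_sub_le {w : ℂ → ℂ} (hd : DifferentiableOn ℂ w (Metric.ball 0 1))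
    (hm : ∀ z ∈ Metric.ball (0 : ℂ) 1, ‖w z‖ < 1) (hw₀ : w 0 = 0) {z : ℂ} (hz : ‖z‖ < 1) :
    ‖w z‖ ≤ ‖z‖ ∧ ‖z * deriv w z - w z‖ * (1 - ‖z‖ ^ 2) ≤ ‖z‖ ^ 2 - ‖w z‖ ^ 2 := by
  have hz' : z ∈ Metric.ball (0 : ℂ) 1 := by simpa using hz
  have hu : DifferentiableOn ℂ (dslope w 0) (Metric.ball 0 1) :=
    (Complex.differentiableOn_dslope (Metric.ball_mem_nhds 0 one_pos)).2 hd
  have hu₁ : ∀ z ∈ Metric.ball (0 : ℂ) 1, ‖dslope w 0 z‖ ≤ 1 := fun z hz => by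
    simpa using Complex.norm_dslope_le_div_of_mapsTo_ball (R₂ := 1) hd
      (fun x hx => by simpa [hw₀] using (hm x hx).le) hz
  have hwu : w = fun z => z * dslope w 0 z := by
    funext z
    have := sub_smul_dslope w 0 z
    simpa [hw₀] using this.symm
  have hud := (hu.differentiableAt (Metric.isOpen_ball.mem_nhds hz')).hasDerivAt
  have hder : deriv w z = dslope w 0 z + z * deriv (dslope w 0) z := by
    have := ((hasDerivAt_id z).mul hud).deriv
    simp only [id, one_mul] at this
    rw [← this]
    congr 1
  have hwz : w z = z * dslope w 0 z := congrFun hwu z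
  have hSP := norm_deriv_mul_le_one_sub_sq_of_norm_le_one hu hu₁ hz
  constructor
  · rw [hwz, norm_mul]
    exact mul_le_of_le_one_right (norm_nonneg z) (hu₁ z hz')
  -- With `w = z u`, `z w' - w = z² u'`, so this is Schwarz–Pick for `u` multiplied by `|z|²`.
  · rw [hder, hwz, show z * (dslope w 0 z + z * deriv (dslope w 0) z) - z * dslope w 0 z =
      z ^ 2 * deriv (dslope w 0) z by ring, norm_mul, norm_mul, norm_pow]
    nlinarith [mul_le_mul_of_nonneg_left hSP (sq_nonneg ‖z‖)]

/-! ### The Schwarzian bound through a strip-valued function. -/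

theorem isOpen_unitDiskC : IsOpen unitDiskC := Metric.isOpen_ball

theorem mem_unitDiskC {z : ℂ} : z ∈ unitDiskC ↔ ‖z‖ < 1 := by simp [unitDiskC]

theorem differentiableOn_preSchwarzian {f : ℂ → ℂ} (hf : DifferentiableOn ℂ f unitDiskC)
    (hf' : ∀ z ∈ unitDiskC, deriv f z ≠ 0) :
    DifferentiableOn ℂ (preSchwarzian f) unitDiskC :=
  ((hf.deriv isOpen_unitDiskC).deriv isOpen_unitDiskC).div (hf.deriv isOpen_unitDiskC) hf'

theorem continuousOn_schwarzian {f : ℂ → ℂ} (hf : DifferentiableOn ℂ f unitDiskC)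
    (hf' : ∀ z ∈ unitDiskC, deriv f z ≠ 0) : ContinuousOn (schwarzian f) unitDiskC := by
  have h := differentiableOn_preSchwarzian hf hf'
  exact (h.deriv isOpen_unitDiskC).continuousOn.sub
    (continuousOn_const.mul (h.continuousOn.pow 2))

/-- The Schwarzian in terms of `p = 1 + z T`, where `T` is the pre-Schwarzian. -/
theorem sq_mul_schwarzian {f p : ℂ → ℂ} {z p' : ℂ} (hz : z ≠ 0)
    (hpf : ∀ u, p u = 1 + u * preSchwarzian f u) (hp : HasDerivAt p p' z) :
    z ^ 2 * schwarzian f z = z * p' + (1 - p z ^ 2) / 2 := by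
  have heq : preSchwarzian f =ᶠ[nhds z] fun u => (p u - 1) / u := by
    filter_upwards [isOpen_ne.mem_nhds hz] with u hu
    have hu : u ≠ 0 := hu
    rw [hpf]; field_simp; ring
  have hd := ((hp.sub_const 1).div (hasDerivAt_id z) hz).congr_of_eventuallyEq heq
  rw [schwarzian, hd.deriv, heq.eq_of_nhds]
  simp only [id]
  field_simp
  ring

theorem normSq_exp_add_one (ζ : ℂ) :
    ‖Complex.exp ζ + 1‖ ^ 2 = 2 * Real.exp ζ.re * (Real.cosh ζ.re + Real.cos ζ.im) := by
  rw [Complex.sq_norm, Complex.normSq_apply]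
  simp only [Complex.add_re, Complex.add_im, Complex.exp_re, Complex.exp_im, Complex.one_re,
    Complex.one_im, Real.cosh_eq]
  have h1 := Real.sin_sq_add_cos_sq ζ.im
  have h2 : Real.exp ζ.re * Real.exp (-ζ.re) = 1 := by rw [← Real.exp_add]; simp
  linear_combination Real.exp ζ.re ^ 2 * h1 - h2

theorem normSq_exp_sub_one (ζ : ℂ) :
    ‖Complex.exp ζ - 1‖ ^ 2 = 2 * Real.exp ζ.re * (Real.cosh ζ.re - Real.cos ζ.im) := by
  rw [Complex.sq_norm, Complex.normSq_apply]
  simp only [Complex.sub_re, Complex.sub_im, Complex.exp_re, Complex.exp_im, Complex.one_re,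
    Complex.one_im, Real.cosh_eq]
  have h1 := Real.sin_sq_add_cos_sq ζ.im
  have h2 : Real.exp ζ.re * Real.exp (-ζ.re) = 1 := by rw [← Real.exp_add]; simp
  linear_combination Real.exp ζ.re ^ 2 * h1 - h2

theorem sinh_eq_re_im (ζ : ℂ) : Complex.sinh ζ =
    ⟨Real.sinh ζ.re * Real.cos ζ.im, Real.cosh ζ.re * Real.sin ζ.im⟩ := by
  conv_lhs => rw [← Complex.re_add_im ζ, Complex.sinh_add, Complex.sinh_mul_I, Complex.cosh_mul_I]
  rw [← Complex.ofReal_sinh, ← Complex.ofReal_cosh, ← Complex.ofReal_sin, ← Complex.ofReal_cos]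
  apply Complex.ext <;>
    simp only [Complex.add_re, Complex.add_im, Complex.mul_re, Complex.mul_im, Complex.ofReal_re,
      Complex.ofReal_im, Complex.I_re, Complex.I_im] <;> ring

theorem normSq_sinh_sub (α : ℝ) (ζ : ℂ) :
    ‖Complex.sinh ζ - Complex.sinh (α * ζ) / α‖ ^ 2 =
      (Real.sinh ζ.re * Real.cos ζ.im -
        Real.sinh (α * ζ.re) / α * Real.cos (α * ζ.im)) ^ 2 +
      (Real.cosh ζ.re * Real.sin ζ.im -
        Real.cosh (α * ζ.re) * (Real.sin (α * ζ.im) / α)) ^ 2 := by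
  rw [Complex.sq_norm, Complex.normSq_apply, sinh_eq_re_im ζ, sinh_eq_re_im (α * ζ)]
  simp only [Complex.sub_re, Complex.sub_im, Complex.div_ofReal_re, Complex.div_ofReal_im,
    Complex.re_ofReal_mul, Complex.im_ofReal_mul]
  ring

theorem exp_add_one_ne_zero {ζ : ℂ} (hζ : |ζ.im| < Real.pi / 2) : Complex.exp ζ + 1 ≠ 0 := by
  intro h
  have h1 := normSq_exp_add_one ζ
  have hc : 0 < Real.cos ζ.im := Real.cos_pos_of_mem_Ioo (abs_lt.1 hζ)
  have : 0 < 2 * Real.exp ζ.re * (Real.cosh ζ.re + Real.cos ζ.im) := by positivity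
  rw [← h1, h] at this
  simp at this

theorem normSq_tanh_half {ζ : ℂ} (hζ : |ζ.im| < Real.pi / 2) :
    ‖(Complex.exp ζ - 1) / (Complex.exp ζ + 1)‖ ^ 2 * (Real.cosh ζ.re + Real.cos ζ.im) =
      Real.cosh ζ.re - Real.cos ζ.im := by
  have hc : 0 < Real.cos ζ.im := Real.cos_pos_of_mem_Ioo (abs_lt.1 hζ)
  have hC := Real.cosh_pos ζ.re
  have := Real.exp_pos ζ.re
  rw [norm_div, div_pow, normSq_exp_add_one, normSq_exp_sub_one]
  field_simp

theorem norm_tanh_half_lt_one {ζ : ℂ} (hζ : |ζ.im| < Real.pi / 2) :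
    ‖(Complex.exp ζ - 1) / (Complex.exp ζ + 1)‖ < 1 := by
  have hc : 0 < Real.cos ζ.im := Real.cos_pos_of_mem_Ioo (abs_lt.1 hζ)
  have hC := Real.cosh_pos ζ.re
  have h := normSq_tanh_half hζ
  by_contra hge
  have h1 := one_le_pow₀ (not_lt.1 hge) (n := 2)
  nlinarith

theorem norm_exp_add_one_sq_div (ζ : ℂ) :
    ‖(Complex.exp ζ + 1) ^ 2 / (2 * Complex.exp ζ)‖ = Real.cosh ζ.re + Real.cos ζ.im := by
  have := Real.exp_pos ζ.re
  rw [norm_div, norm_mul, norm_pow, normSq_exp_add_one, Complex.norm_exp]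
  rw [Complex.norm_ofNat]
  field_simp

/-- The Schwarzian of a function with `1 + z T = exp (α ζ)`, where `ζ` maps the disk into
the strip `|Im ζ| < π / 2` and vanishes at the origin. -/
theorem schwarzian_bound_of_strip {α : ℝ} (hα₀ : 0 < α) (hα₁ : α < 1) {f ζ : ℂ → ℂ}
    (hζd : DifferentiableOn ℂ ζ unitDiskC) (hζ₀ : ζ 0 = 0)
    (hζ : ∀ z ∈ unitDiskC, |(ζ z).im| < Real.pi / 2)
    (hfζ : ∀ z ∈ unitDiskC, 1 + z * preSchwarzian f z = Complex.exp (α * ζ z))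
    {z : ℂ} (hz : z ∈ unitDiskC) (hz₀ : z ≠ 0) :
    (1 - ‖z‖ ^ 2) ^ 2 * ‖schwarzian f z‖ ≤ 2 * α := by
  have hαC : (α : ℂ) ≠ 0 := by exact_mod_cast hα₀.ne'
  have hz₁ : ‖z‖ < 1 := mem_unitDiskC.1 hz
  have hζz := (hζd.differentiableAt (isOpen_unitDiskC.mem_nhds hz)).hasDerivAt
  have hwd : ∀ u ∈ unitDiskC, HasDerivAt
      (fun u => (Complex.exp (ζ u) - 1) / (Complex.exp (ζ u) + 1))
      (2 * Complex.exp (ζ u) / (Complex.exp (ζ u) + 1) ^ 2 * deriv ζ u) u := by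
    intro u hu
    have h := (hζd.differentiableAt (isOpen_unitDiskC.mem_nhds hu)).hasDerivAt.cexp
    refine ((h.sub_const 1).div (h.add_const 1) (exp_add_one_ne_zero (hζ u hu))).congr_deriv ?_
    ring
  have hSP := norm_mul_deriv_sub_le
    (w := fun u => (Complex.exp (ζ u) - 1) / (Complex.exp (ζ u) + 1))
    (fun u hu => (hwd u hu).differentiableAt.differentiableWithinAt)
    (fun u hu => norm_tanh_half_lt_one (hζ u hu)) (by simp [hζ₀]) hz₁
  rw [(hwd z hz).deriv] at hSP
  have hp : HasDerivAt (fun u => 1 + u * preSchwarzian f u)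
      (Complex.exp (α * ζ z) * (α * deriv ζ z)) z := by
    refine (hζz.const_mul (α : ℂ)).cexp.congr_of_eventuallyEq ?_
    filter_upwards [isOpen_unitDiskC.mem_nhds hz] with u hu using hfζ u hu
  have hS := sq_mul_schwarzian hz₀ (fun _ => rfl) hp
  rw [hfζ z hz] at hS
  have hx₀ := exp_add_one_ne_zero (hζ z hz)
  have hx₁ := normSq_tanh_half (hζ z hz)
  have hx₂ := norm_exp_add_one_sq_div (ζ z)
  have hx₃ := normSq_sinh_sub α (ζ z)
  have hx₄ := hζ z hz
  generalize deriv ζ z = ζ' at *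
  generalize ζ z = x at *
  have hex := Complex.exp_ne_zero x
  have hepx := Complex.exp_ne_zero (α * x)
  -- Uses `(1 - exp (2αx))/2 = -exp (αx) sinh (αx)` and `(exp x + 1)²/(2 exp x) · tanh (x/2) = sinh
  -- x`.
  have hdecomp : z ^ 2 * schwarzian f z = α * Complex.exp (α * x) *
      ((Complex.sinh x - Complex.sinh (α * x) / α) +
        (Complex.exp x + 1) ^ 2 / (2 * Complex.exp x) *
          (z * (2 * Complex.exp x / (Complex.exp x + 1) ^ 2 * ζ') -
            (Complex.exp x - 1) / (Complex.exp x + 1))) := by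
    rw [hS, Complex.sinh, Complex.sinh, Complex.exp_neg, Complex.exp_neg]
    field_simp
    ring
  have hnorm := congrArg norm hdecomp
  rw [norm_mul, norm_pow, norm_mul, norm_mul, Complex.norm_real, Real.norm_of_nonneg hα₀.le,
    Complex.norm_exp, Complex.re_ofReal_mul] at hnorm
  have htri := norm_add_le (Complex.sinh x - Complex.sinh (α * x) / α)
    ((Complex.exp x + 1) ^ 2 / (2 * Complex.exp x) *
          (z * (2 * Complex.exp x / (Complex.exp x + 1) ^ 2 * ζ') -
            (Complex.exp x - 1) / (Complex.exp x + 1)))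
  rw [norm_mul _ (_ - _), hx₂] at htri
  obtain ⟨hw, hδ⟩ := hSP
  have hωz := pow_le_pow_left₀ (norm_nonneg _) hw 2
  generalize ‖z * (2 * Complex.exp x / (Complex.exp x + 1) ^ 2 * ζ') -
            (Complex.exp x - 1) / (Complex.exp x + 1)‖ = δ at *
  generalize ‖(Complex.exp x - 1) / (Complex.exp x + 1)‖ = ω at *
  have hc : 0 < Real.cos x.im := Real.cos_pos_of_mem_Ioo (abs_lt.1 hx₄)
  have hC := Real.cosh_pos x.re
  have hz2 : ‖z‖ ^ 2 < 1 := pow_lt_one₀ (norm_nonneg _) hz₁ two_ne_zero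
  have hzpos : 0 < ‖z‖ ^ 2 := by positivity
  have hq := quadratic_bound hα₀ hα₁ hx₄ hx₃ (y := 1 - ‖z‖ ^ 2) (by linarith)
    (by nlinarith only [hωz, hx₁, hc, hC])
  have hE : Real.exp (α * x.re) * Real.exp (-(α * x.re)) = 1 := by rw [← Real.exp_add]; simp
  have hepos := Real.exp_pos (α * x.re)
  generalize Real.exp (α * x.re) = e at *
  generalize Real.exp (-(α * x.re)) = E at *
  generalize ‖Complex.sinh x - Complex.sinh (α * x) / α‖ = D at *
  generalize Real.cosh x.re = C at *
  generalize Real.cos x.im = c at *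
  generalize ‖schwarzian f z‖ = σ at *
  -- Schwarz–Pick gives `y (C + c) δ ≤ (C + c)(|z|² - ω²) = 2c - y (C + c)`, which turns the claim
  -- into the quadratic inequality.
  have h1 : (1 - ‖z‖ ^ 2) ^ 2 * (D + (C + c) * δ) ≤ 2 * ‖z‖ ^ 2 * E := by
    have h2 := mul_le_mul_of_nonneg_left hδ
      (show 0 ≤ (1 - ‖z‖ ^ 2) * (C + c) from mul_nonneg (by linarith) (by linarith))
    nlinarith only [h2, hq, hx₁]
  have h3 : ‖z‖ ^ 2 * ((1 - ‖z‖ ^ 2) ^ 2 * σ) ≤ ‖z‖ ^ 2 * (2 * α) := by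
    calc ‖z‖ ^ 2 * ((1 - ‖z‖ ^ 2) ^ 2 * σ) = (1 - ‖z‖ ^ 2) ^ 2 * (‖z‖ ^ 2 * σ) := by ring
      _ ≤ (1 - ‖z‖ ^ 2) ^ 2 * (α * e * (D + (C + c) * δ)) := by
        rw [hnorm]; gcongr
      _ = α * e * ((1 - ‖z‖ ^ 2) ^ 2 * (D + (C + c) * δ)) := by ring
      _ ≤ α * e * (2 * ‖z‖ ^ 2 * E) := by gcongr
      _ = ‖z‖ ^ 2 * (2 * α) * (e * E) := by ring
      _ = ‖z‖ ^ 2 * (2 * α) := by rw [hE, mul_one]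
  exact le_of_mul_le_mul_left h3 hzpos

theorem StronglyConvexOfOrder.schwarzian_bound {α : ℝ} (hα₀ : 0 < α) (hα₁ : α < 1) {f : ℂ → ℂ}
    (hf : StronglyConvexOfOrder α f) {z : ℂ} (hz : z ∈ unitDiskC) :
    (1 - ‖z‖ ^ 2) ^ 2 * ‖schwarzian f z‖ ≤ 2 * α := by
  obtain ⟨⟨hfd, -, -⟩, h⟩ := hf
  have hαC : (α : ℂ) ≠ 0 := by exact_mod_cast hα₀.ne'
  have hpre := differentiableOn_preSchwarzian hfd fun z hz => (h z hz).1
  have hne : ∀ u ∈ unitDiskC, u ≠ 0 → (1 - ‖u‖ ^ 2) ^ 2 * ‖schwarzian f u‖ ≤ 2 * α := by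
    intro u hu hu₀
    refine schwarzian_bound_of_strip hα₀ hα₁
      (ζ := fun z => Complex.log (1 + z * preSchwarzian f z) / α) ?_ (by simp) ?_ ?_ hu hu₀
    · refine (((differentiableOn_const 1).add (differentiableOn_id.mul hpre)).clog ?_).div_const _
      intro z hz
      -- On the negative real axis the argument is `π`, which exceeds `πα/2`.
      refine Complex.mem_slitPlane_iff_arg.2 ⟨fun harg => ?_, (h z hz).2.1⟩
      have := (abs_lt.1 (h z hz).2.2).2
      simp only [Pi.add_apply, Pi.mul_apply] at harg
      rw [harg] at this
      nlinarith [Real.pi_pos]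
    · intro z hz
      rw [Complex.div_ofReal_im, Complex.log_im, abs_div, abs_of_pos hα₀, div_lt_iff₀ hα₀]
      linarith [(h z hz).2.2]
    · intro z hz
      rw [mul_div_cancel₀ _ hαC, Complex.exp_log (h z hz).2.1]
  rcases eq_or_ne z 0 with rfl | hz₀
  -- The decomposition controls only `z² S_f`, so the bound at the origin comes by continuity.
  · have hcont : ContinuousAt (fun z => (1 - ‖z‖ ^ 2) ^ 2 * ‖schwarzian f z‖) 0 := by
      have := (continuousOn_schwarzian hfd fun z hz => (h z hz).1).continuousAt
        (isOpen_unitDiskC.mem_nhds hz)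
      fun_prop
    have hlim := hcont.tendsto.mono_left (nhdsWithin_le_nhds (s := {0}ᶜ))
    refine le_of_tendsto hlim ?_
    filter_upwards [self_mem_nhdsWithin,
      nhdsWithin_le_nhds (isOpen_unitDiskC.mem_nhds hz)] with u hu₀ hu using hne u hu hu₀
  · exact hne z hz hz₀

theorem StronglyConvexOfOrder.schwarzianNorm_le {α : ℝ} (hα₀ : 0 < α) (hα₁ : α < 1) {f : ℂ → ℂ}
    (hf : StronglyConvexOfOrder α f) : schwarzianNorm f ≤ ENNReal.ofReal (2 * α) :=
  iSup₂_le fun _ hz => ENNReal.ofReal_le_ofReal (hf.schwarzian_bound hα₀ hα₁ hz)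

/-! ### The extremal function. -/

/-- The function `v ↦ ((1 + v) / (1 - v)) ^ α`. -/
noncomputable def extremalPower (α : ℝ) (v : ℂ) : ℂ := ((1 + v) / (1 - v)) ^ (α : ℂ)

theorem one_sub_ne_zero_of_mem {v : ℂ} (hv : v ∈ unitDiskC) : 1 - v ≠ 0 := by
  intro h
  have : v = 1 := by linear_combination -h
  rw [mem_unitDiskC, this] at hv
  simp at hv

theorem sq_mem_unitDiskC {z : ℂ} (hz : z ∈ unitDiskC) : z ^ 2 ∈ unitDiskC := by
  rw [mem_unitDiskC] at *
  rw [norm_pow]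
  exact pow_lt_one₀ (norm_nonneg _) hz two_ne_zero

theorem re_cayley_pos {v : ℂ} (hv : v ∈ unitDiskC) : 0 < ((1 + v) / (1 - v)).re := by
  have hne := one_sub_ne_zero_of_mem hv
  have hv2 : ‖v‖ ^ 2 < 1 := pow_lt_one₀ (norm_nonneg _) (mem_unitDiskC.1 hv) two_ne_zero
  rw [Complex.sq_norm, Complex.normSq_apply] at hv2
  rw [Complex.div_re, ← add_div]
  refine div_pos ?_ (Complex.normSq_pos.2 hne)
  simp
  nlinarith

theorem hasDerivAt_extremalPower (α : ℝ) {v : ℂ} (hv : v ∈ unitDiskC) :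
    HasDerivAt (extremalPower α)
      (α * ((1 + v) / (1 - v)) ^ ((α : ℂ) - 1) * (2 / (1 - v) ^ 2)) v := by
  have hne := one_sub_ne_zero_of_mem hv
  have h : HasDerivAt (fun v : ℂ => (1 + v) / (1 - v)) (2 / (1 - v) ^ 2) v := by
    refine (((hasDerivAt_id v).const_add 1).div ((hasDerivAt_id v).const_sub 1) hne).congr_deriv ?_
    simp only [id]
    ring
  exact h.cpow_const (Or.inl (re_cayley_pos hv))

theorem zero_mem_unitDiskC : (0 : ℂ) ∈ unitDiskC := by simp [mem_unitDiskC]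

theorem differentiableOn_dslope_extremalPower (α : ℝ) :
    DifferentiableOn ℂ (dslope (extremalPower α) 0) unitDiskC :=
  (Complex.differentiableOn_dslope (isOpen_unitDiskC.mem_nhds zero_mem_unitDiskC)).2
    fun _ hv => (hasDerivAt_extremalPower α hv).differentiableAt.differentiableWithinAt

theorem dslope_extremalPower_zero (α : ℝ) : dslope (extremalPower α) 0 0 = 2 * α := by
  rw [dslope_same, (hasDerivAt_extremalPower α zero_mem_unitDiskC).deriv]
  simp
  ring

/-- The pre-Schwarzian derivative of the extremal function. -/
noncomputable def extremalPreSchwarzian (α : ℝ) (z : ℂ) : ℂ :=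
  z * dslope (extremalPower α) 0 (z ^ 2)

theorem differentiableOn_extremalPreSchwarzian (α : ℝ) :
    DifferentiableOn ℂ (extremalPreSchwarzian α) unitDiskC :=
  differentiableOn_id.mul ((differentiableOn_dslope_extremalPower α).comp
    (differentiableOn_id.pow 2) fun _ hz => sq_mem_unitDiskC hz)

theorem one_add_mul_extremalPreSchwarzian (α : ℝ) (z : ℂ) :
    1 + z * extremalPreSchwarzian α z = ((1 + z ^ 2) / (1 - z ^ 2)) ^ (α : ℂ) := by
  have h := sub_smul_dslope (extremalPower α) 0 (z ^ 2)
  simp only [sub_zero, smul_eq_mul] at h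
  rw [extremalPreSchwarzian, show z * (z * dslope (extremalPower α) 0 (z ^ 2)) =
    z ^ 2 * dslope (extremalPower α) 0 (z ^ 2) by ring, h]
  simp [extremalPower]

theorem hasDerivAt_extremalPreSchwarzian_zero (α : ℝ) :
    HasDerivAt (extremalPreSchwarzian α) (2 * α) 0 := by
  have hd : DifferentiableAt ℂ (fun z : ℂ => dslope (extremalPower α) 0 (z ^ 2)) 0 :=
    ((differentiableOn_dslope_extremalPower α).comp
      (differentiableOn_id.pow 2) fun _ hz => sq_mem_unitDiskC hz).differentiableAt
      (isOpen_unitDiskC.mem_nhds zero_mem_unitDiskC)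
  refine ((hasDerivAt_id (0 : ℂ)).mul hd.hasDerivAt).congr_deriv ?_
  simpa using dslope_extremalPower_zero α

theorem IsExtremalStronglyConvex.preSchwarzian_eq {α : ℝ} {f : ℂ → ℂ}
    (hf : IsExtremalStronglyConvex α f) :
    Set.EqOn (preSchwarzian f) (extremalPreSchwarzian α) unitDiskC := by
  have hpre := differentiableOn_preSchwarzian hf.1.1 fun z hz => (hf.2 z hz).1
  have hne : ∀ z ∈ unitDiskC, z ≠ 0 → preSchwarzian f z = extremalPreSchwarzian α z := by
    intro z hz hz₀
    have h1 := (hf.2 z hz).2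
    rw [← one_add_mul_extremalPreSchwarzian] at h1
    exact mul_left_cancel₀ hz₀ (add_left_cancel h1)
  intro z hz
  rcases eq_or_ne z 0 with rfl | hz₀
  · have h1 := (hpre.continuousOn.continuousAt (isOpen_unitDiskC.mem_nhds hz)).tendsto.mono_left
      (nhdsWithin_le_nhds (s := {0}ᶜ))
    have h2 := ((differentiableOn_extremalPreSchwarzian α).continuousOn.continuousAt
      (isOpen_unitDiskC.mem_nhds hz)).tendsto.mono_left (nhdsWithin_le_nhds (s := {0}ᶜ))
    refine tendsto_nhds_unique_of_eventuallyEq h1 h2 ?_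
    filter_upwards [self_mem_nhdsWithin,
      nhdsWithin_le_nhds (isOpen_unitDiskC.mem_nhds hz)] with u hu₀ hu using hne u hu hu₀
  · exact hne z hz hz₀

theorem isPreconnected_unitDiskC : IsPreconnected unitDiskC :=
  (convex_ball (0 : ℂ) 1).isPreconnected

/-- Normalized functions are determined by their pre-Schwarzian derivatives. -/
theorem eqOn_of_preSchwarzian_eqOn {f g : ℂ → ℂ} (hf : NormalizedAnalytic f)
    (hg : NormalizedAnalytic g) (hf' : ∀ z ∈ unitDiskC, deriv f z ≠ 0)
    (hg' : ∀ z ∈ unitDiskC, deriv g z ≠ 0)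
    (h : Set.EqOn (preSchwarzian g) (preSchwarzian f) unitDiskC) : Set.EqOn g f unitDiskC := by
  have hdf := hf.1.deriv isOpen_unitDiskC
  have hdg := hg.1.deriv isOpen_unitDiskC
  have hderiv : Set.EqOn (deriv g) (deriv f) unitDiskC := by
    have hquot : ∀ z ∈ unitDiskC, HasDerivAt (fun z => deriv g z / deriv f z) 0 z := by
      intro z hz
      refine ((hdg.differentiableAt (isOpen_unitDiskC.mem_nhds hz)).hasDerivAt.div
        (hdf.differentiableAt (isOpen_unitDiskC.mem_nhds hz)).hasDerivAt
        (hf' z hz)).congr_deriv ?_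
      have h1 := h hz
      rw [preSchwarzian, preSchwarzian, div_eq_div_iff (hg' z hz) (hf' z hz)] at h1
      rw [h1]
      ring
    intro z hz
    have hc := isOpen_unitDiskC.is_const_of_deriv_eq_zero isPreconnected_unitDiskC
      (fun z hz => (hquot z hz).differentiableAt.differentiableWithinAt)
      (fun z hz => (hquot z hz).deriv) hz zero_mem_unitDiskC
    simp only [hf.2.2, hg.2.2, div_one] at hc
    exact (div_eq_one_iff_eq (hf' z hz)).1 hc
  exact isOpen_unitDiskC.eqOn_of_deriv_eq isPreconnected_unitDiskC hg.1 hf.1 hderiv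
    zero_mem_unitDiskC (by rw [hf.2.1, hg.2.1])

/-- If `H` is the primitive of the prescribed pre-Schwarzian with `H 0 = 0`, then `f' = exp H` is
zero-free with logarithmic derivative `H'`; a second integration gives `f`. -/
theorem exists_isExtremalStronglyConvex (α : ℝ) : ∃ f, IsExtremalStronglyConvex α f := by
  obtain ⟨H, hH₀, hH⟩ := ((differentiableOn_extremalPreSchwarzian α).isExactOn_ball).with_val_at 0 0
  have hexp : DifferentiableOn ℂ (fun z => Complex.exp (H z)) (Metric.ball 0 1) := fun z hz =>
    (hH z hz).differentiableAt.cexp.differentiableWithinAt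
  obtain ⟨f, hf₀, hf⟩ := hexp.isExactOn_ball.with_val_at 0 0
  have hder : ∀ z ∈ unitDiskC, deriv f z = Complex.exp (H z) := fun z hz => (hf z hz).deriv
  have hder₂ : ∀ z ∈ unitDiskC, preSchwarzian f z = extremalPreSchwarzian α z := by
    intro z hz
    have heq : deriv f =ᶠ[nhds z] fun z => Complex.exp (H z) := by
      filter_upwards [isOpen_unitDiskC.mem_nhds hz] with u hu using hder u hu
    rw [preSchwarzian, heq.deriv_eq, (hH z hz).cexp.deriv, hder z hz,
      mul_div_cancel_left₀ _ (Complex.exp_ne_zero _)]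
  refine ⟨f, ⟨fun z hz => (hf z hz).differentiableAt.differentiableWithinAt, hf₀, ?_⟩,
    fun z hz => ⟨?_, ?_⟩⟩
  · rw [hder 0 zero_mem_unitDiskC, hH₀, Complex.exp_zero]
  · rw [hder z hz]
    exact Complex.exp_ne_zero _
  · rw [hder₂ z hz, one_add_mul_extremalPreSchwarzian]

theorem IsExtremalStronglyConvex.stronglyConvexOfOrder {α : ℝ} (hα₀ : 0 < α) (hα₁ : α < 1)
    {f : ℂ → ℂ} (hf : IsExtremalStronglyConvex α f) : StronglyConvexOfOrder α f := by
  refine ⟨hf.1, fun z hz => ⟨(hf.2 z hz).1, ?_⟩⟩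
  rw [(hf.2 z hz).2]
  have hre := re_cayley_pos (sq_mem_unitDiskC hz)
  have hne : (1 + z ^ 2) / (1 - z ^ 2) ≠ 0 := fun h => by simp [h] at hre
  have harg := Complex.abs_arg_lt_pi_div_two_iff.2 (Or.inl hre)
  generalize (1 + z ^ 2) / (1 - z ^ 2) = v at *
  have him : (Complex.log v * α).im = α * v.arg := by
    rw [Complex.im_mul_ofReal, Complex.log_im, mul_comm]
  have habs : |α * v.arg| < Real.pi * α / 2 := by
    rw [abs_mul, abs_of_pos hα₀]
    nlinarith
  have hmem : α * v.arg ∈ Set.Ioc (-Real.pi) Real.pi := by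
    have h1 := abs_lt.1 habs
    constructor <;> nlinarith [Real.pi_pos]
  rw [Complex.cpow_def_of_ne_zero hne]
  refine ⟨Complex.exp_ne_zero _, ?_⟩
  -- As `α · arg v` lies in `(-π, π]`, no multiple of `2π` has to be subtracted.
  rw [Complex.arg_exp, him, (toIocMod_eq_self Real.two_pi_pos).2]
  · exact habs
  · rwa [show -Real.pi + 2 * Real.pi = Real.pi by ring]

theorem IsExtremalStronglyConvex.schwarzian_zero {α : ℝ} {f : ℂ → ℂ}
    (hf : IsExtremalStronglyConvex α f) : schwarzian f 0 = 2 * (α : ℂ) := by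
  have heq : preSchwarzian f =ᶠ[nhds 0] extremalPreSchwarzian α := by
    filter_upwards [isOpen_unitDiskC.mem_nhds zero_mem_unitDiskC] with u hu
      using hf.preSchwarzian_eq hu
  rw [schwarzian, heq.deriv_eq, heq.eq_of_nhds, (hasDerivAt_extremalPreSchwarzian_zero α).deriv]
  simp [extremalPreSchwarzian]

theorem theorem1 (α : ℝ) (hα₀ : 0 < α) (hα₁ : α < 1) :
    (∀ f : ℂ → ℂ, StronglyConvexOfOrder α f →
      schwarzianNorm f ≤ ENNReal.ofReal (2 * α)) ∧
    ∃ fα : ℂ → ℂ, IsExtremalStronglyConvex α fα ∧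
      (∀ g : ℂ → ℂ, IsExtremalStronglyConvex α g → Set.EqOn g fα unitDiskC) ∧
      StronglyConvexOfOrder α fα ∧
      schwarzian fα 0 = 2 * (α : ℂ) ∧
      schwarzianNorm fα = ENNReal.ofReal (2 * α) := by
  refine ⟨fun f hf => hf.schwarzianNorm_le hα₀ hα₁, ?_⟩
  obtain ⟨f, hf⟩ := exists_isExtremalStronglyConvex α
  have hsc := hf.stronglyConvexOfOrder hα₀ hα₁
  refine ⟨f, hf, fun g hg => ?_, hsc, hf.schwarzian_zero, ?_⟩
  · exact eqOn_of_preSchwarzian_eqOn hf.1 hg.1 (fun z hz => (hf.2 z hz).1)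
      (fun z hz => (hg.2 z hz).1) fun z hz =>
        (hg.preSchwarzian_eq hz).trans (hf.preSchwarzian_eq hz).symm
  · refine le_antisymm (hsc.schwarzianNorm_le hα₀ hα₁) ?_
    -- The supremum is attained at the origin.
    refine le_trans (ENNReal.ofReal_le_ofReal ?_) (le_iSup₂_of_le 0 zero_mem_unitDiskC le_rfl)
    rw [hf.schwarzian_zero]
    simp [abs_of_pos hα₀]
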